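/- Let $n,N\ge 0$, let $\Pi=\{0,\dots,n\}$ be a set of processes, and let $x^*_0,\dots,x^*_n\in\mathbb R^N$ be affinely independent (the vertices of an $n$-simplex $S^n$). Executions. $IS_n$ is the set of directed graphs $G$ on $\Pi$ such that $(a,b),(b,c)\in A(G)$ implies $(a,c)\in A(G)$, and such that $(a,b)\in A(G)$ or $(b,a)\in A(G)$ for all $a,b\in\Pi$ (in particular, all loops are present). $IIS_n=IS_n^{\omega}$ is the set of infinite words $w=G_1G_2\cdots$ over $IS_n$. Fairness. For $p,q\in\Pi$ and $r\in\mathbb N$ there is a journey in $w$ at time $r$ from $p$ to $q$ if there are $p=p_0,p_1,\dots,p_t=q$ in $\Pi$ and integers $r\le i_0<i_1<\dots<i_t$ with $(p_{j-1},p_j)\in A(G_{i_j})$ for $0<j\le t$. For $P\subseteq\Pi$, $w$ is Fair on $P$ if in every $G_r$ no process of $P$ receives an arc from a process outside $P$, and if for all $p,q\in P$ and all $r\in\mathbb N$ there is a journey in $w$ at time $r$ from $p$ to $q$. Geometrization. The Chromatic Average algorithm starts with $x_i(0)=x_i^*$ for $i\in\Pi$; at round $r\ge1$, if $V_i=\{j:(j,i)\in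 A(G_r)\}$ has $d+1$ elements, then $$x_i(r)=\frac{1-\frac{d}{2d+1}}{d+1}\,x_i(r-1)+\sum_{j\in V_i\setminus\{i\}}\frac{1+\frac1{2d+1}}{d+1}\,x_j(r-1).$$ Let $geo(w)$ be the limit of the isobarycentres $\frac1{n+1}\sum_i x_i(r)$ as $r\to\infty$. The geo-class of $w$ is $\Sigma=\{w'\in IIS_n: geo(w')=geo(w)\}$. The geometrization topology on $IIS_n$ has as its open sets the preimages $geo^{-1}(\Omega)$ of the open sets $\Omega\subseteq\mathbb R^N$; two executions are non-separable if they have no disjoint open neighbourhoods in it. Theorem. For every $w\in IIS_n$, the limit $geo(w)$ exists and $x_i(r)\to geo(w)$ for every $i\in\Pi$. Moreover: 1. if $w$ is Fair on $\Pi$, or Fair on $\Pi\setminus\{p\}$ for some $p\in\Pi$, then $\#\Sigma=1$; 2. if for some $p\in\Pi$ the word $w$ has only a strict suffix that is Fair on $\Pi\setminus\{p\}$ (that is, some suffix of $w$ is Fair on $\Pi\setminus\{p\}$ but $w$ itself is not), then $\#\Sigma=2$; 3. in all other cases $\Sigma$ is infinite. The set of executions that are non-separable from $w$ (including $w$ itself)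 is exactly $\Sigma$; hence it has size $1$, $2$ or is infinite. -/

import Mathlib

open Filter Topology

namespace ChromaticAverage

/-- Immediacy: arcs `(a, b)` and `(b, c)` force the arc `(a, c)`. -/
def Immediacy {V : Type*} (G : Digraph V) : Prop :=
  ∀ a b c, G.Adj a b → G.Adj b c → G.Adj a c

/-- Containment: any two vertices `a`, `b` (equal or not) are joined by an arc in at least one
direction; in particular every process receives its own message. -/
def Containment {V : Type*} (G : Digraph V) : Prop :=
  ∀ a b, G.Adj a b ∨ G.Adj b a

/-- The instant graphs `IS_n` on the processes `0, …, n`. -/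
def IS (n : ℕ) : Set (Digraph (Fin (n + 1))) :=
  {G | Immediacy G ∧ Containment G}

/-- The executions `IIS_n = IS_n^ω`. The word `G₁ G₂ ⋯` is the function `w` with
`w r = G_{r+1}`. -/
abbrev IIS (n : ℕ) : Type := ℕ → IS n

/-- `Arc w k p q`: the `k`-th letter `G_k` of `w` (counted from `1`) has the arc `(p, q)`. -/
def Arc {n : ℕ} (w : IIS n) (k : ℕ) (p q : Fin (n + 1)) : Prop :=
  (w (k - 1)).1.Adj p q

/-- The suffix of `w` obtained by deleting its first `k` letters. -/
def suffix {n : ℕ} (k : ℕ) (w : IIS n) : IIS n := fun r => w (k + r)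

/-- There is a journey in `w` at time `r` from `p` to `q`: processes `p₀ = p, …, p_t = q` and
times `r ≤ i₀ < i₁ < ⋯ < i_t` such that `(p_{j-1}, p_j)` is an arc of the `i_j`-th letter
for `0 < j ≤ t`. -/
def Journey {n : ℕ} (w : IIS n) (r : ℕ) (p q : Fin (n + 1)) : Prop :=
  ∃ (t : ℕ) (π : ℕ → Fin (n + 1)) (i : ℕ → ℕ),
    r ≤ i 0 ∧ (∀ j < t, i j < i (j + 1)) ∧ π 0 = p ∧ π t = q ∧
      ∀ j < t, Arc w (i (j + 1)) (π j) (π (j + 1))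

/-- The instant graphs in which no process of `P` receives a message from outside `P`. -/
def Solo {n : ℕ} (P : Set (Fin (n + 1))) : Set (IS n) :=
  {G | ∀ p q, G.1.Adj p q → q ∈ P → p ∈ P}

/-- `w` is fair on `P`. -/
def Fair {n : ℕ} (P : Set (Fin (n + 1))) (w : IIS n) : Prop :=
  (∀ r, w r ∈ Solo P) ∧ ∀ p ∈ P, ∀ q ∈ P, ∀ r, Journey w r p q

/-- The processes whose messages `i` receives under the instant graph `G`. -/
noncomputable def view {n : ℕ} (G : IS n) (i : Fin (n + 1)) : Finset (Fin (n + 1)) :=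
  open Classical in Finset.univ.filter fun j => G.1.Adj j i

/-- The point `ζ_V(x_i)`, where `V` has `d + 1` elements, one of which is `i`. -/
noncomputable def zeta {ι E : Type*} [DecidableEq ι] [AddCommGroup E] [Module ℝ E]
    (V : Finset ι) (x : ι → E) (i : ι) : E :=
  let d : ℝ := (V.card : ℝ) - 1
  ((1 - d / (2 * d + 1)) / (d + 1)) • x i +
    ∑ j ∈ V.erase i, ((1 + 1 / (2 * d + 1)) / (d + 1)) • x j

/-- One round `μ_G` of the Chromatic Average algorithm under the instant graph `G`. -/
noncomputable def mu {n : ℕ} {E : Type*} [AddCommGroup E] [Module ℝ E]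
    (G : IS n) (x : Fin (n + 1) → E) : Fin (n + 1) → E :=
  fun i => zeta (view G i) x i

/-- The vertices of the simplex `μ_{G_r} ∘ ⋯ ∘ μ_{G_1} (S)`, indexed by processes. -/
noncomputable def state {n : ℕ} {E : Type*} [AddCommGroup E] [Module ℝ E]
    (S : Fin (n + 1) → E) (w : IIS n) : ℕ → Fin (n + 1) → E
  | 0 => S
  | r + 1 => mu (w r) (state S w r)

/-- The geometrization of `w`: the limit of the isobarycentres of the simplices reached
after `r` rounds. -/
noncomputable def geo {n N : ℕ} (S : Fin (n + 1) → EuclideanSpace ℝ (Fin N)) (w : IIS n) :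
    EuclideanSpace ℝ (Fin N) :=
  limUnder atTop fun r : ℕ => ((n : ℝ) + 1)⁻¹ • ∑ i, state S w r i

/-- The geo-class of `w`. -/
def geoClass {n N : ℕ} (S : Fin (n + 1) → EuclideanSpace ℝ (Fin N)) (w : IIS n) :
    Set (IIS n) :=
  {w' | geo S w' = geo S w}

/-- The geometrization topology: the open sets are the preimages of open sets under `geo`. -/
noncomputable abbrev geoTopology {n N : ℕ} (S : Fin (n + 1) → EuclideanSpace ℝ (Fin N)) :
    TopologicalSpace (IIS n) :=
  TopologicalSpace.induced (geo S) inferInstance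

/-- `w` and `w'` have no disjoint open neighbourhoods in the geometrization topology. -/
def NonSeparable {n N : ℕ} (S : Fin (n + 1) → EuclideanSpace ℝ (Fin N)) (w w' : IIS n) : Prop :=
  ¬ ∃ A B : Set (IIS n), IsOpen[geoTopology S] A ∧ IsOpen[geoTopology S] B ∧
    w ∈ A ∧ w' ∈ B ∧ Disjoint A B

/-- `w` is fair on the set `Π` of all processes, or on `Π ∖ {p}` for some `p`. -/
def Class₁ {n : ℕ} (w : IIS n) : Prop :=
  Fair Set.univ w ∨ ∃ p, Fair {p}ᶜ w

/-- `w` has only a strict suffix that is fair on `Π ∖ {p}`, for some `p`: a suffix of `w` is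
fair on `Π ∖ {p}`, but `w` itself is not. -/
def Class₂ {n : ℕ} (w : IIS n) : Prop :=
  ∃ p, ¬ Fair {p}ᶜ w ∧ ∃ k, Fair {p}ᶜ (suffix k w)

end ChromaticAverage

/-!
Everything is read off barycentric coordinates. Let `lam w` be the vector of coordinates of the
limit of `w`, and let `supp w k` be the set of processes on which the limit of the suffix of `w`
after `k` letters is supported.

*The limit exists.* One round replaces each point by a convex combination of the points that it
sees, all weights being at least `1 / (2 n + 1)`. Two processes always have a common process in
their views, so the oscillation of every coordinate shrinks by the factor `1 - 1 / (2 n + 1)`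
(`sum_wt_sub_le`), and all states converge to one point (`tendsto_coef`). By affine independence
`geo S w` carries the same information as `lam w` (`geo_eq_iff`).

*Rigidity of one round.* If a point `y` has barycentric coordinates `x` in the simplex obtained
from the instant graph `G`, put `a i = x i / (2 d + 1)`, where `i` sees `d + 1` processes, and let
`f j` be the sum of `a i` over the processes `i` that see `j`. Then `y = 2 f - a`. Since the views
form a chain, the mass of `a` at the levels of `f` up to `f i` is exactly `f i`, and a minimality
argument (`eq_of_level_sum`) shows that `y` then determines `f` and `a`. A process `i` with
`a i > 0` sees exactly the processes `j` with `f i ≤ f j`, so `y` determines its view as well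
(`eq_and_view_eq_of_sum_mul_wt_eq`).

*Geo-classes.* Applied to all suffixes, rigidity and contraction show that `w` and `w'` have the
same limit if and only if, for each `k`, the graphs `w k` and `w' k` give the same views to the
processes in `supp w (k + 1)` (`lam_eq_iff`). The elements of a geo-class are thus counted round by
round.

*Fairness.* The sets `supp w k` decrease to some nonempty `Q`, and `w` is fair on a nonempty set `P`
if and only if `supp w k = P` for all `k` (`fair_iff_supp_eq`). If all the sets `supp w k` are
`Π`, or all are `Π ∖ {p}`, the views determine every letter. If they pass from `Π` to `Π ∖ {p}`,
this happens at one round, in which `p` is heard by another process; then the view of `p` can be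
completed in exactly two ways (`encard_view_eq_off`), and all other letters are determined. If `Q`
misses two processes, every late round leaves a choice (`exists_ne_view_eq_on`), so the class is
infinite.
-/

namespace ChromaticAverage

open Finset

variable {n : ℕ}

/-! ### The averaging weights -/

/-- The weight of `x j` in the point `mu G x i`. With `d + 1 = #(view G i)` it is `1 / (2 d + 1)`
for `j = i` and `2 / (2 d + 1)` for the other processes in the view. -/
noncomputable def wt (G : IS n) (i j : Fin (n + 1)) : ℝ :=
  open Classical in
  if G.1.Adj j i then (if j = i then 1 else 2) / (2 * ((view G i).card : ℝ) - 1) else 0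

lemma mem_view {G : IS n} {i j : Fin (n + 1)} : j ∈ view G i ↔ G.1.Adj j i := by
  simp [view]

lemma adj_self (G : IS n) (i : Fin (n + 1)) : G.1.Adj i i := by
  simpa using G.2.2 i i

lemma adj_trans (G : IS n) {a b c : Fin (n + 1)} (h : G.1.Adj a b) (h' : G.1.Adj b c) :
    G.1.Adj a c := G.2.1 a b c h h'

lemma adj_total (G : IS n) (a b : Fin (n + 1)) : G.1.Adj a b ∨ G.1.Adj b a := G.2.2 a b

lemma one_le_card_view (G : IS n) (i : Fin (n + 1)) : (1 : ℝ) ≤ (view G i).card := by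
  exact_mod_cast Finset.card_pos.2 ⟨i, mem_view.2 (adj_self G i)⟩

lemma card_view_le (G : IS n) (i : Fin (n + 1)) : ((view G i).card : ℝ) ≤ n + 1 := by
  have h := Finset.card_le_univ (view G i)
  rw [Fintype.card_fin] at h
  exact_mod_cast h

/-- A round is linear, with the weights `wt`. -/
lemma mu_eq_sum {E : Type*} [AddCommGroup E] [Module ℝ E] (G : IS n) (x : Fin (n + 1) → E)
    (i : Fin (n + 1)) : mu G x i = ∑ j, wt G i j • x j := by
  have hc := one_le_card_view G i
  have h1 : ∑ j, wt G i j • x j = ∑ j ∈ view G i, wt G i j • x j := by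
    symm
    apply Finset.sum_subset (Finset.subset_univ _)
    intro j _ hj
    rw [mem_view] at hj
    simp [wt, hj]
  rw [h1, ← Finset.add_sum_erase _ _ (mem_view.2 (adj_self G i))]
  dsimp only [mu, zeta]
  have e1 : 2 * ((view G i).card : ℝ) - 1 ≠ 0 := by linarith
  have e2 : 2 * (((view G i).card : ℝ) - 1) + 1 = 2 * ((view G i).card : ℝ) - 1 := by ring
  have e3 : ((view G i).card : ℝ) ≠ 0 := by linarith
  rw [e2, sub_add_cancel]
  refine congrArg₂ (· + ·) ?_ ?_
  · congr 1
    simp only [wt, adj_self, if_true]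
    rw [div_eq_div_iff e3 e1, sub_mul, div_mul_cancel₀ _ e1]
    ring
  · refine Finset.sum_congr rfl fun j hj => ?_
    have hj' := Finset.mem_erase.1 hj
    congr 1
    simp only [wt, mem_view.1 hj'.2, hj'.1, if_true, if_false]
    rw [div_eq_div_iff e3 e1, add_mul, div_mul_cancel₀ _ e1]
    ring

lemma wt_nonneg (G : IS n) (i j : Fin (n + 1)) : 0 ≤ wt G i j := by
  have hc := one_le_card_view G i
  unfold wt
  split_ifs <;> first | exact le_rfl | exact div_nonneg (by norm_num) (by linarith)

lemma wt_pos_iff {G : IS n} {i j : Fin (n + 1)} : 0 < wt G i j ↔ G.1.Adj j i := by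
  have hc := one_le_card_view G i
  unfold wt
  split_ifs with h h' <;> simp only [h, iff_true, lt_irrefl]
  all_goals exact div_pos (by norm_num) (by linarith)

lemma wt_sum (G : IS n) (i : Fin (n + 1)) : ∑ j, wt G i j = 1 := by
  have h := mu_eq_sum G (fun _ => (1 : ℝ)) i
  have hc := one_le_card_view G i
  simp only [smul_eq_mul, mul_one] at h
  rw [← h]
  have e1 : (2 * (((view G i).card : ℝ) - 1) + 1) ≠ 0 := by linarith
  have e3 : (((view G i).card : ℝ) - 1 + 1) ≠ 0 := by linarith
  simp only [mu, zeta, smul_eq_mul, mul_one, Finset.sum_const, nsmul_eq_mul,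
    Finset.card_erase_of_mem (mem_view.2 (adj_self G i))]
  rw [Nat.cast_sub (by exact_mod_cast hc)]
  push_cast
  field_simp
  ring

lemma wt_ge {G : IS n} {i j : Fin (n + 1)} (h : G.1.Adj j i) :
    1 / (2 * (n : ℝ) + 1) ≤ wt G i j := by
  have hc := one_le_card_view G i
  have hc' := card_view_le G i
  rw [wt, if_pos h]
  apply div_le_div₀ <;> [split_ifs <;> norm_num; split_ifs <;> norm_num; linarith; linarith]

/-- The weights of `i` depend only on its view. -/
lemma wt_congr {G H : IS n} {i : Fin (n + 1)} (h : view G i = view H i) (j : Fin (n + 1)) :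
    wt G i j = wt H i j := by
  have : G.1.Adj j i ↔ H.1.Adj j i := by rw [← mem_view, ← mem_view, h]
  by_cases hj : H.1.Adj j i
  · rw [wt, wt, if_pos (this.2 hj), if_pos hj, h]
  · rw [wt, wt, if_neg (mt this.1 hj), if_neg hj]

/-! ### Rigidity of the chromatic subdivision -/

section Level

variable {ι : Type*} [Fintype ι]

/-- The two functions cannot first disagree, going up the levels, with `g` below `f`: the mass of
`a` up to a suitable level `f m` would be at least `g m + 2 (f m - g m)`, which exceeds `f m`. -/
lemma not_lt_of_level_sum {f g a b : ι → ℝ} (ha : ∀ i, 0 ≤ a i)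
    (hf : ∀ i, ∑ j with f j ≤ f i, a j = f i) (hg : ∀ i, ∑ j with g j ≤ g i, b j = g i)
    (h : ∀ i, 2 * f i - a i = 2 * g i - b i) (i : ι)
    (hmin : ∀ j, f j ≠ g j → g i ≤ min (f j) (g j)) : ¬ g i < f i := by
  intro hi
  -- among the indices at the least bad level of `g`, take one where `f` is largest
  obtain ⟨m, hm, hmax⟩ := Finset.exists_max_image (univ.filter fun j => g j = g i ∧ g j < f j) f
    ⟨i, by simp [hi]⟩
  simp only [Finset.mem_filter, Finset.mem_univ, true_and] at hm hmax
  have hle : ∀ j, g j ≤ g m → b j ≤ a j ∧ f j ≤ f m := by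
    intro j hj
    by_cases e : f j = g j
    · have := h j
      constructor <;> linarith [hm.2]
    · have h1 := hmin j e
      have h2 := le_min_iff.1 h1
      have h3 : g j = g i := le_antisymm (hj.trans hm.1.le) h2.2
      have h4 : g j < f j := lt_of_le_of_ne (h3 ▸ h2.1) (Ne.symm e)
      have := h j
      exact ⟨by linarith, hmax j ⟨h3, h4⟩⟩
  have h1 : ∑ j with g j ≤ g m, a j ≤ ∑ j with f j ≤ f m, a j := by
    apply Finset.sum_le_sum_of_subset_of_nonneg
    · intro j
      simp only [Finset.mem_filter, Finset.mem_univ, true_and]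
      exact fun hj => (hle j hj).2
    · exact fun j _ _ => ha j
  have h2 : a m - b m ≤ ∑ j with g j ≤ g m, (a j - b j) := by
    apply Finset.single_le_sum (f := fun j => a j - b j)
    · intro j hj
      simp only [Finset.mem_filter, Finset.mem_univ, true_and] at hj
      exact sub_nonneg.2 (hle j hj).1
    · simp
  rw [Finset.sum_sub_distrib, hg m] at h2
  rw [hf m] at h1
  have := h m
  linarith [hm.2]

/-- A function `f` whose jumps are carried by the nonnegative masses `a`, in the sense that each
value `f i` is the total mass at the levels up to `f i`, is determined by `2 f - a`. -/
lemma eq_of_level_sum {f g a b : ι → ℝ} (ha : ∀ i, 0 ≤ a i) (hb : ∀ i, 0 ≤ b i)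
    (hf : ∀ i, ∑ j with f j ≤ f i, a j = f i) (hg : ∀ i, ∑ j with g j ≤ g i, b j = g i)
    (h : ∀ i, 2 * f i - a i = 2 * g i - b i) : f = g := by
  by_contra hne
  obtain ⟨k, hk⟩ := Function.ne_iff.1 hne
  obtain ⟨i, hi, hmin⟩ := Finset.exists_min_image (univ.filter fun j => f j ≠ g j)
    (fun j => min (f j) (g j)) ⟨k, by simpa using hk⟩
  simp only [Finset.mem_filter, Finset.mem_univ, true_and] at hi hmin
  rcases lt_or_gt_of_ne hi with hlt | hlt
  · refine not_lt_of_level_sum hb hg hf (fun j => (h j).symm) i (fun j hj => ?_) hlt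
    have := hmin j hj.symm
    rwa [min_eq_left hlt.le, min_comm] at this
  · refine not_lt_of_level_sum ha hf hg h i (fun j hj => ?_) hlt
    have := hmin j hj
    rwa [min_eq_right hlt.le] at this

end Level

/-- The weight `x i / (2 d + 1)` that the point with barycentric coordinates `x` gives to the
process `i`, where `i` sees `d + 1` processes. -/
noncomputable def mass (G : IS n) (x : Fin (n + 1) → ℝ) (i : Fin (n + 1)) : ℝ :=
  x i / (2 * ((view G i).card : ℝ) - 1)

/-- The total mass of the processes that see `j`. -/
noncomputable def height (G : IS n) (x : Fin (n + 1) → ℝ) (j : Fin (n + 1)) : ℝ :=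
  open Classical in ∑ i with G.1.Adj j i, mass G x i

section Mass

variable {G : IS n} {x : Fin (n + 1) → ℝ}

lemma mass_nonneg (hx : ∀ i, 0 ≤ x i) (i : Fin (n + 1)) : 0 ≤ mass G x i :=
  div_nonneg (hx i) (by linarith [one_le_card_view G i])

lemma mass_pos_iff {i : Fin (n + 1)} : 0 < mass G x i ↔ 0 < x i := by
  have := one_le_card_view G i
  exact div_pos_iff_of_pos_right (by linarith)

/-- The coordinates `2 f - a` of a point of the subdivision: each process that sees `j` contributes
twice its mass, except that `j` itself contributes its mass only once. -/
lemma sum_mul_wt (j : Fin (n + 1)) :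
    ∑ i, x i * wt G i j = 2 * height G x j - mass G x j := by
  classical
  have h1 : mass G x j = ∑ i with G.1.Adj j i, if i = j then mass G x i else 0 := by
    rw [Finset.sum_ite_eq' _ j]
    simp [adj_self]
  rw [h1, height, Finset.mul_sum, ← Finset.sum_sub_distrib, Finset.sum_filter]
  refine Finset.sum_congr rfl fun i _ => ?_
  unfold wt mass
  by_cases h : G.1.Adj j i
  · by_cases e : i = j
    · subst e; simp only [h, if_true]; ring
    · simp only [h, e, Ne.symm e, if_true, if_false]; ring
  · simp [h]

lemma height_le_of_adj (hx : ∀ i, 0 ≤ x i) {i j : Fin (n + 1)} (h : G.1.Adj j i) :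
    height G x i ≤ height G x j := by
  apply Finset.sum_le_sum_of_subset_of_nonneg
  · intro k
    simp only [Finset.mem_filter, Finset.mem_univ, true_and]
    exact fun hk => adj_trans G h hk
  · exact fun k _ _ => mass_nonneg hx k

lemma height_add_mass_le (hx : ∀ i, 0 ≤ x i) {i j : Fin (n + 1)} (h : ¬ G.1.Adj j i) :
    height G x j + mass G x i ≤ height G x i := by
  classical
  have hij : G.1.Adj i j := (adj_total G i j).resolve_right h
  rw [height, height, add_comm, ← Finset.sum_insert (by simp [h])]
  apply Finset.sum_le_sum_of_subset_of_nonneg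
  · intro k
    simp only [Finset.mem_insert, Finset.mem_filter, Finset.mem_univ, true_and]
    rintro (rfl | hk)
    · exact adj_self G _
    · exact adj_trans G hij hk
  · exact fun k _ _ => mass_nonneg hx k

/-- The processes whose height is at most that of `i` are, up to massless ones, those that
see `i`. -/
lemma level_sum_height (hx : ∀ i, 0 ≤ x i) (i : Fin (n + 1)) :
    ∑ j with height G x j ≤ height G x i, mass G x j = height G x i := by
  classical
  conv_rhs => rw [height]
  symm
  apply Finset.sum_subset
  · intro k
    simp only [Finset.mem_filter, Finset.mem_univ, true_and]
    exact height_le_of_adj hx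
  · intro k
    simp only [Finset.mem_filter, Finset.mem_univ, true_and]
    intro hk hik
    have := height_add_mass_le hx hik
    exact le_antisymm (by linarith) (mass_nonneg hx k)

/-- A process of positive mass sees exactly the processes at least as high as itself. -/
lemma mem_view_iff_height_le (hx : ∀ i, 0 ≤ x i) {i : Fin (n + 1)} (hi : 0 < x i)
    (j : Fin (n + 1)) : j ∈ view G i ↔ height G x i ≤ height G x j := by
  rw [mem_view]
  refine ⟨height_le_of_adj hx, fun h => ?_⟩
  by_contra hn
  have := height_add_mass_le hx hn
  have := (mass_pos_iff (G := G)).2 hi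
  linarith

end Mass

/-- The simplices of the chromatic subdivision meet along common faces: a point determines its
barycentric coordinates in a simplex of the subdivision containing it, and the views of the
processes that support it. -/
theorem eq_and_view_eq_of_sum_mul_wt_eq {G H : IS n} {x z : Fin (n + 1) → ℝ}
    (hx : ∀ i, 0 ≤ x i) (hz : ∀ i, 0 ≤ z i)
    (h : ∀ j, ∑ i, x i * wt G i j = ∑ i, z i * wt H i j) :
    x = z ∧ ∀ i, 0 < x i → view G i = view H i := by
  have hh : height G x = height H z :=
    eq_of_level_sum (mass_nonneg hx) (mass_nonneg hz) (level_sum_height hx) (level_sum_height hz)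
      fun j => by rw [← sum_mul_wt, ← sum_mul_wt, h j]
  have hm : ∀ i, mass G x i = mass H z i := fun i => by
    have := h i
    rw [sum_mul_wt, sum_mul_wt, hh] at this
    linarith
  have hpos : ∀ i, 0 < x i ↔ 0 < z i := fun i => by
    rw [← mass_pos_iff (G := G), hm, mass_pos_iff]
  have hv : ∀ i, 0 < x i → view G i = view H i := fun i hi => by
    ext j
    rw [mem_view_iff_height_le hx hi, mem_view_iff_height_le hz ((hpos i).1 hi), hh]
  refine ⟨funext fun i => ?_, hv⟩
  rcases (hx i).eq_or_lt with h0 | h0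
  · rcases (hz i).eq_or_lt with h1 | h1
    · rw [← h0, ← h1]
    · exact absurd ((hpos i).2 h1) (h0 ▸ lt_irrefl _)
  · have := hm i
    have hc := one_le_card_view H i
    rw [mass, mass, hv i h0] at this
    exact (div_left_inj' (by linarith)).1 this

/-! ### Barycentric coordinates of the states and of the limit -/

/-- The barycentric coordinate along the vertex `j` of the state of `i` after `r` rounds: by
linearity, it is the state computed from the indicator function of `j`. -/
noncomputable def coef (w : IIS n) (r : ℕ) (i j : Fin (n + 1)) : ℝ :=
  state (fun k => if k = j then (1 : ℝ) else 0) w r i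

lemma coef_zero (w : IIS n) (i j : Fin (n + 1)) : coef w 0 i j = if i = j then 1 else 0 := rfl

lemma coef_succ (w : IIS n) (r : ℕ) (i j : Fin (n + 1)) :
    coef w (r + 1) i j = ∑ k, wt (w r) i k * coef w r k j :=
  mu_eq_sum (w r) _ i

lemma state_eq_sum {E : Type*} [AddCommGroup E] [Module ℝ E] (S : Fin (n + 1) → E) (w : IIS n)
    (r : ℕ) (i : Fin (n + 1)) : state S w r i = ∑ j, coef w r i j • S j := by
  induction r generalizing i with
  | zero => simp [coef_zero, state]
  | succ r ih =>
    rw [state, mu_eq_sum]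
    simp only [ih, coef_succ, Finset.sum_smul, Finset.smul_sum, mul_smul]
    rw [Finset.sum_comm]

lemma state_succ_eq_suffix {E : Type*} [AddCommGroup E] [Module ℝ E] (S : Fin (n + 1) → E)
    (w : IIS n) (r : ℕ) : state S w (r + 1) = state (mu (w 0) S) (suffix 1 w) r := by
  induction r with
  | zero => rfl
  | succ r ih =>
    rw [state, ih, state, suffix, add_comm 1 r]

lemma coef_succ_eq_suffix (w : IIS n) (r : ℕ) (i j : Fin (n + 1)) :
    coef w (r + 1) i j = ∑ k, coef (suffix 1 w) r i k * wt (w 0) k j := by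
  rw [coef, state_succ_eq_suffix, state_eq_sum]
  simp [mu_eq_sum]

lemma coef_nonneg (w : IIS n) (r : ℕ) (i j : Fin (n + 1)) : 0 ≤ coef w r i j := by
  induction r generalizing i with
  | zero => rw [coef_zero]; split_ifs <;> norm_num
  | succ r ih =>
    rw [coef_succ]
    exact Finset.sum_nonneg fun k _ => mul_nonneg (wt_nonneg _ _ _) (ih k)

lemma coef_sum (w : IIS n) (r : ℕ) (i : Fin (n + 1)) : ∑ j, coef w r i j = 1 := by
  induction r generalizing i with
  | zero => simp [coef_zero]
  | succ r ih =>
    simp only [coef_succ]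
    rw [Finset.sum_comm]
    simp only [← Finset.mul_sum, ih, mul_one, wt_sum]

/-- A round contracts the oscillation: of two processes one sees the other, so both give a weight
of at least `1 / (2 n + 1)` to a common process. -/
lemma sum_wt_sub_le (G : IS n) {x : Fin (n + 1) → ℝ} {D : ℝ} (h : ∀ i j, x i - x j ≤ D)
    (i j : Fin (n + 1)) :
    ∑ k, wt G i k * x k - ∑ k, wt G j k * x k ≤ (1 - 1 / (2 * (n : ℝ) + 1)) * D := by
  obtain ⟨M, -, hM⟩ := Finset.exists_max_image univ x univ_nonempty
  obtain ⟨m, -, hm⟩ := Finset.exists_min_image univ x univ_nonempty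
  obtain ⟨k, hki, hkj⟩ : ∃ k, G.1.Adj k i ∧ G.1.Adj k j := by
    rcases adj_total G i j with h | h
    · exact ⟨i, adj_self G i, h⟩
    · exact ⟨j, h, adj_self G j⟩
  set c : ℝ := 1 / (2 * (n : ℝ) + 1) with hc
  have hM' : ∀ l, 0 ≤ x M - x l := fun l => sub_nonneg.2 (hM l (mem_univ l))
  have hm' : ∀ l, 0 ≤ x l - x m := fun l => sub_nonneg.2 (hm l (mem_univ l))
  have h1 : c * (x M - x k) ≤ ∑ l, wt G i l * (x M - x l) :=
    (mul_le_mul_of_nonneg_right (wt_ge hki) (hM' k)).trans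
      (Finset.single_le_sum (f := fun l => wt G i l * (x M - x l))
        (fun l _ => mul_nonneg (wt_nonneg _ _ _) (hM' l)) (mem_univ k))
  have h2 : c * (x k - x m) ≤ ∑ l, wt G j l * (x l - x m) :=
    (mul_le_mul_of_nonneg_right (wt_ge hkj) (hm' k)).trans
      (Finset.single_le_sum (f := fun l => wt G j l * (x l - x m))
        (fun l _ => mul_nonneg (wt_nonneg _ _ _) (hm' l)) (mem_univ k))
  simp only [mul_sub, Finset.sum_sub_distrib, ← Finset.sum_mul, wt_sum, one_mul] at h1 h2
  have hc1 : c ≤ 1 := by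
    rw [hc, div_le_one (by positivity)]
    linarith [(Nat.cast_nonneg n : (0 : ℝ) ≤ n)]
  have h3 := mul_le_mul_of_nonneg_left (h M m) (sub_nonneg.2 hc1)
  linarith

lemma coef_sub_le (w : IIS n) (r : ℕ) (i k j : Fin (n + 1)) :
    coef w r i j - coef w r k j ≤ (1 - 1 / (2 * (n : ℝ) + 1)) ^ r := by
  induction r generalizing i k with
  | zero =>
    rw [coef_zero, coef_zero]
    split_ifs <;> norm_num
  | succ r ih =>
    rw [coef_succ, coef_succ, pow_succ']
    exact sum_wt_sub_le _ ih i k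

lemma abs_coef_sub_le (w : IIS n) (r : ℕ) (i k j : Fin (n + 1)) :
    |coef w r i j - coef w r k j| ≤ (1 - 1 / (2 * (n : ℝ) + 1)) ^ r :=
  abs_le.2 ⟨by linarith [coef_sub_le w r k i j], coef_sub_le w r i k j⟩

lemma dist_coef_succ_le (w : IIS n) (r : ℕ) (i j : Fin (n + 1)) :
    dist (coef w r i j) (coef w (r + 1) i j) ≤ 1 * (1 - 1 / (2 * (n : ℝ) + 1)) ^ r := by
  have h : coef w r i j - coef w (r + 1) i j
      = ∑ k, wt (w r) i k * (coef w r i j - coef w r k j) := by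
    simp only [mul_sub, Finset.sum_sub_distrib, ← Finset.sum_mul, wt_sum, one_mul, coef_succ]
  rw [Real.dist_eq, h, one_mul]
  have hD := abs_coef_sub_le w r (j := j)
  set D := (1 - 1 / (2 * (n : ℝ) + 1)) ^ r
  rw [← one_mul D, ← wt_sum (w r) i, Finset.sum_mul]
  refine (Finset.abs_sum_le_sum_abs _ _).trans (Finset.sum_le_sum fun k _ => ?_)
  rw [abs_mul, abs_of_nonneg (wt_nonneg _ _ _)]
  exact mul_le_mul_of_nonneg_left (hD i k) (wt_nonneg _ _ _)

/-- The barycentric coordinates of the limit of an execution. They are defined through the states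
of the process `0`; every process gives the same limit, by `tendsto_coef`. -/
noncomputable def lam (w : IIS n) (j : Fin (n + 1)) : ℝ :=
  limUnder atTop fun r => coef w r 0 j

lemma tendsto_coef (w : IIS n) (i j : Fin (n + 1)) :
    Tendsto (fun r => coef w r i j) atTop (𝓝 (lam w j)) := by
  have hn : (0 : ℝ) < 2 * (n : ℝ) + 1 := by positivity
  have hc : 1 / (2 * (n : ℝ) + 1) ≤ 1 := by
    rw [div_le_one hn]
    linarith [(Nat.cast_nonneg n : (0 : ℝ) ≤ n)]
  have hlt : 1 - 1 / (2 * (n : ℝ) + 1) < 1 := by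
    linarith [one_div_pos.2 hn]
  have h0 : Tendsto (fun r => coef w r 0 j) atTop (𝓝 (lam w j)) :=
    (cauchySeq_of_le_geometric _ _ hlt fun r => dist_coef_succ_le w r 0 j).tendsto_limUnder
  have h1 : Tendsto (fun r => coef w r i j - coef w r 0 j) atTop (𝓝 0) :=
    squeeze_zero_norm (fun r => abs_coef_sub_le w r i 0 j)
      (tendsto_pow_atTop_nhds_zero_of_lt_one (by linarith) hlt)
  simpa using h1.add h0

lemma lam_nonneg (w : IIS n) (j : Fin (n + 1)) : 0 ≤ lam w j :=
  ge_of_tendsto' (tendsto_coef w 0 j) fun r => coef_nonneg w r 0 j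

lemma lam_sum (w : IIS n) : ∑ j, lam w j = 1 := by
  refine tendsto_nhds_unique (tendsto_finsetSum univ fun j _ => tendsto_coef w 0 j) ?_
  simp only [coef_sum]
  exact tendsto_const_nhds

lemma suffix_zero (w : IIS n) : suffix 0 w = w := by
  funext r; simp [suffix]

lemma suffix_suffix (k l : ℕ) (w : IIS n) : suffix l (suffix k w) = suffix (k + l) w := by
  funext r; simp [suffix, add_assoc]

/-- The limit of a word is the point that has, in the simplex reached after the first letter, the
barycentric coordinates of the limit of the remaining word. -/
lemma lam_suffix (w : IIS n) (k : ℕ) (j : Fin (n + 1)) :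
    lam (suffix k w) j = ∑ i, lam (suffix (k + 1) w) i * wt (w k) i j := by
  refine tendsto_nhds_unique ((tendsto_coef (suffix k w) 0 j).comp (tendsto_add_atTop_nat 1)) ?_
  simp only [Function.comp_def, coef_succ_eq_suffix, suffix_suffix]
  exact tendsto_finsetSum _ fun i _ => (tendsto_coef _ 0 i).mul_const _

/-! ### Limits in the simplex -/

section Geo

variable {N : ℕ} (S : Fin (n + 1) → EuclideanSpace ℝ (Fin N))

lemma tendsto_state_sum (w : IIS n) (i : Fin (n + 1)) :
    Tendsto (fun r => state S w r i) atTop (𝓝 (∑ j, lam w j • S j)) := by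
  simp only [state_eq_sum]
  exact tendsto_finsetSum _ fun j _ => (tendsto_coef w i j).smul_const _

lemma geo_eq_sum (w : IIS n) : geo S w = ∑ j, lam w j • S j := by
  apply Tendsto.limUnder_eq
  have h := (tendsto_finsetSum univ fun i _ => tendsto_state_sum S w i).const_smul
    (((n : ℝ) + 1)⁻¹)
  have hn : (n : ℝ) + 1 ≠ 0 := by positivity
  rw [Finset.sum_const, ← Nat.cast_smul_eq_nsmul ℝ, smul_smul] at h
  simpa [hn] using h

variable {S}

lemma geo_eq_iff (hS : AffineIndependent ℝ S) (w w' : IIS n) :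
    geo S w' = geo S w ↔ lam w' = lam w := by
  rw [geo_eq_sum, geo_eq_sum]
  refine ⟨fun h => ?_, fun h => by rw [h]⟩
  refine (affineIndependent_iff_eq_of_fintype_affineCombination_eq ℝ S).1 hS _ _ (lam_sum w')
    (lam_sum w) ?_
  rw [Finset.affineCombination_eq_linear_combination _ _ _ (lam_sum w'),
    Finset.affineCombination_eq_linear_combination _ _ _ (lam_sum w), h]

end Geo

/-! ### The support of the limit -/

/-- The processes that support the limit of the word after its first `k` letters. -/
def supp (w : IIS n) (k : ℕ) : Set (Fin (n + 1)) :=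
  {j | 0 < lam (suffix k w) j}

lemma mem_supp_iff {w : IIS n} {k : ℕ} {j : Fin (n + 1)} :
    j ∈ supp w k ↔ ∃ i ∈ supp w (k + 1), (w k).1.Adj j i := by
  have h0 : ∀ i ∈ univ, 0 ≤ lam (suffix (k + 1) w) i * wt (w k) i j := fun i _ =>
    mul_nonneg (lam_nonneg _ _) (wt_nonneg _ _ _)
  change 0 < lam (suffix k w) j ↔ _
  rw [lam_suffix, Finset.sum_pos_iff_of_nonneg h0]
  refine exists_congr fun i => ?_
  rw [← wt_pos_iff]
  refine ⟨fun h => ⟨?_, ?_⟩, fun h => ⟨mem_univ i, mul_pos h.1 h.2⟩⟩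
  · exact pos_of_mul_pos_left h.2 (wt_nonneg _ _ _)
  · exact pos_of_mul_pos_right h.2 (lam_nonneg _ _)

lemma supp_antitone (w : IIS n) : Antitone (supp w) :=
  antitone_nat_of_succ_le fun _ j hj => mem_supp_iff.2 ⟨j, hj, adj_self _ j⟩

lemma supp_nonempty (w : IIS n) (k : ℕ) : (supp w k).Nonempty := by
  obtain ⟨j, -, hj⟩ := Finset.exists_lt_of_sum_lt
    (s := univ) (f := fun _ => (0 : ℝ)) (g := lam (suffix k w)) (by simp [lam_sum])
  exact ⟨j, hj⟩

lemma supp_suffix (w : IIS n) (k l : ℕ) : supp (suffix k w) l = supp w (k + l) := by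
  rw [supp, supp, suffix_suffix]

/-- The supports decrease, so they are eventually constant. -/
lemma exists_supp_eq (w : IIS n) : ∃ K, ∀ k, K ≤ k → supp w k = supp w K := by
  obtain ⟨K, hK⟩ := WellFoundedLT.antitone_chain_condition (supp_antitone w)
  exact ⟨K, fun k hk => (hK k hk).symm⟩

/-! ### The geo-class in terms of views -/

/-- The word `w` may be replaced by `w'` in its first `r` rounds if the views agree where it
matters. -/
lemma lam_eq_sum_coef {w w' : IIS n}
    (h : ∀ k, ∀ i ∈ supp w (k + 1), view (w k) i = view (w' k) i) (r : ℕ) (j : Fin (n + 1)) :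
    lam w j = ∑ i, lam (suffix r w) i * coef w' r i j := by
  induction r with
  | zero => simp [coef_zero, suffix_zero]
  | succ r ih =>
    simp only [ih, lam_suffix w r, coef_succ, Finset.sum_mul, Finset.mul_sum]
    rw [Finset.sum_comm]
    refine Finset.sum_congr rfl fun i _ => Finset.sum_congr rfl fun k _ => ?_
    rcases (lam_nonneg (suffix (r + 1) w) i).eq_or_lt with h0 | h0
    · simp [← h0]
    · rw [wt_congr (h r i h0), mul_assoc]

lemma lam_eq_of_view_eq {w w' : IIS n}
    (h : ∀ k, ∀ i ∈ supp w (k + 1), view (w k) i = view (w' k) i) : lam w' = lam w := by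
  funext j
  have h1 : ∀ r, |lam w j - lam w' j| ≤ ∑ i, |coef w' r i j - lam w' j| := fun r => by
    have e : lam w j - lam w' j = ∑ i, lam (suffix r w) i * (coef w' r i j - lam w' j) := by
      simp only [mul_sub, Finset.sum_sub_distrib, ← Finset.sum_mul, lam_sum, one_mul,
        ← lam_eq_sum_coef h r j]
    rw [e]
    refine (Finset.abs_sum_le_sum_abs _ _).trans (Finset.sum_le_sum fun i _ => ?_)
    rw [abs_mul, abs_of_nonneg (lam_nonneg _ _)]
    refine mul_le_of_le_one_left (abs_nonneg _) ?_
    rw [← lam_sum (suffix r w)]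
    exact Finset.single_le_sum (fun i _ => lam_nonneg _ i) (mem_univ i)
  have h2 : Tendsto (fun r => ∑ i, |coef w' r i j - lam w' j|) atTop (𝓝 0) := by
    have := tendsto_finsetSum univ fun i _ =>
      ((tendsto_coef w' i j).sub_const (lam w' j)).abs
    simpa using this
  have h3 := ge_of_tendsto' h2 h1
  have h4 := abs_nonpos_iff.1 h3
  linarith

/-- Two words have the same limit exactly when, at each round, they give the same views to the
processes that support the limit of what follows. -/
theorem lam_eq_iff {w w' : IIS n} :
    lam w' = lam w ↔ ∀ k, ∀ i ∈ supp w (k + 1), view (w k) i = view (w' k) i := by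
  refine ⟨fun h => ?_, lam_eq_of_view_eq⟩
  have key : ∀ k, lam (suffix k w) = lam (suffix k w') →
      lam (suffix (k + 1) w) = lam (suffix (k + 1) w') ∧
        ∀ i, 0 < lam (suffix (k + 1) w) i → view (w k) i = view (w' k) i := fun k hk =>
    eq_and_view_eq_of_sum_mul_wt_eq (lam_nonneg _) (lam_nonneg _) fun j => by
      rw [← lam_suffix, ← lam_suffix, hk]
  have hall : ∀ k, lam (suffix k w) = lam (suffix k w') := fun k => by
    induction k with
    | zero => rw [suffix_zero, suffix_zero, h]
    | succ k ih => exact (key k ih).1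
  exact fun k => (key k (hall k)).2

/-! ### Fairness and supports -/

/-- A version of `Journey.of_coef_pos` that bounds the time of the last arc, so that the journey can
be prolonged by a later arc. -/
lemma journey_of_coef_pos {w : IIS n} {r t : ℕ} {p q : Fin (n + 1)}
    (h : 0 < coef (suffix r w) t q p) :
    ∃ (m : ℕ) (π : ℕ → Fin (n + 1)) (i : ℕ → ℕ), r ≤ i 0 ∧ i m ≤ r + t ∧
      (∀ j < m, i j < i (j + 1)) ∧ π 0 = p ∧ π m = q ∧
        ∀ j < m, Arc w (i (j + 1)) (π j) (π (j + 1)) := by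
  induction t generalizing q with
  | zero =>
    rw [coef_zero] at h
    have hqp : q = p := by
      by_contra hne
      simp [hne] at h
    exact ⟨0, fun _ => p, fun _ => r, le_rfl, le_rfl, by simp, rfl, hqp.symm, by simp⟩
  | succ t ih =>
    rw [coef_succ, Finset.sum_pos_iff_of_nonneg fun k _ =>
      mul_nonneg (wt_nonneg _ _ _) (coef_nonneg _ _ _ _)] at h
    obtain ⟨k, -, hk⟩ := h
    have hkq := wt_pos_iff.1 (pos_of_mul_pos_left hk (coef_nonneg _ _ _ _))
    obtain ⟨m, π, i, h0, hm, hi, hp, hq, ha⟩ := ih (pos_of_mul_pos_right hk (wt_nonneg _ _ _))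
    refine ⟨m + 1, fun j => if j ≤ m then π j else q, fun j => if j ≤ m then i j else r + t + 1,
      by simpa using h0, by simp [add_assoc], fun j hj => ?_, by simpa using hp, by simp,
      fun j hj => ?_⟩
    · rcases (Nat.lt_succ_iff.1 hj).eq_or_lt with rfl | hlt
      · simpa using Nat.lt_succ_of_le hm
      · simpa [hlt.le, Nat.succ_le_of_lt hlt] using hi j hlt
    · rcases (Nat.lt_succ_iff.1 hj).eq_or_lt with rfl | hlt
      · simpa [Arc, hq, suffix] using hkq
      · simpa [hlt.le, Nat.succ_le_of_lt hlt] using ha j hlt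

/-- Information flows from `p` to `q` along journeys only. -/
lemma Journey.of_coef_pos {w : IIS n} {r t : ℕ} {p q : Fin (n + 1)}
    (h : 0 < coef (suffix r w) t q p) : Journey w r p q := by
  obtain ⟨m, π, i, h0, -, hi, hp, hq, ha⟩ := journey_of_coef_pos h
  exact ⟨m, π, i, h0, hi, hp, hq, ha⟩

lemma Journey.of_mem_supp {w : IIS n} {r : ℕ} {p : Fin (n + 1)} (hp : p ∈ supp w r)
    (q : Fin (n + 1)) : Journey w r p q := by
  obtain ⟨t, ht⟩ := ((tendsto_coef (suffix r w) q p).eventually_const_lt hp).exists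
  exact Journey.of_coef_pos ht

/-- A journey that ends in a set which no message enters starts in it. -/
lemma Journey.mem_of_solo {w : IIS n} {r : ℕ} {p q : Fin (n + 1)} {Q : Set (Fin (n + 1))}
    (h : Journey w r p q) (hQ : ∀ k, r ≤ k → w k ∈ Solo Q) (hq : q ∈ Q) : p ∈ Q := by
  obtain ⟨t, π, i, h0, hi, rfl, rfl, ha⟩ := h
  have hri : ∀ j ≤ t, r + j ≤ i j := fun j hj => by
    induction j with
    | zero => simpa using h0
    | succ j ih =>
      have h1 := ih (by lia)
      have h2 := hi j (by lia)
      lia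
  have hback : ∀ j ≤ t, π (t - j) ∈ Q := fun j hj => by
    induction j with
    | zero => simpa using hq
    | succ j ih =>
      have h1 := ih (by lia)
      have e : t - j = t - (j + 1) + 1 := by lia
      rw [e] at h1
      have h2 := hri (t - (j + 1) + 1) (by lia)
      exact hQ _ (by lia) _ _ (ha (t - (j + 1)) (by lia)) h1
  simpa using hback t le_rfl

lemma solo_of_supp_eq {w : IIS n} {Q : Set (Fin (n + 1))} {k : ℕ} (h : supp w k = Q)
    (h' : supp w (k + 1) = Q) : w k ∈ Solo Q := by
  rintro p q hpq hq
  rw [← h]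
  exact mem_supp_iff.2 ⟨q, h' ▸ hq, hpq⟩

/-- Fairness on `P` means that the limits of all suffixes are supported by exactly `P`. -/
theorem fair_iff_supp_eq {P : Set (Fin (n + 1))} (hP : P.Nonempty) {w : IIS n} :
    Fair P w ↔ ∀ k, supp w k = P := by
  constructor
  · rintro ⟨hsolo, hj⟩
    obtain ⟨q, hq⟩ := hP
    have hsub : ∀ k, supp w k ⊆ P := fun k p hp =>
      (Journey.of_mem_supp hp q).mem_of_solo (fun l _ => hsolo l) hq
    obtain ⟨K, hK⟩ := exists_supp_eq w
    -- no message enters the eventual support, yet journeys lead there from all of `P`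
    have hsup : P ⊆ supp w K := fun p hp => by
      obtain ⟨s, hs⟩ := supp_nonempty w K
      exact (hj p hp s (hsub K hs) K).mem_of_solo
        (fun l hl => solo_of_supp_eq (hK l hl) (hK (l + 1) (by lia))) hs
    intro k
    refine (hsub k).antisymm ?_
    rcases le_total k K with h | h
    · exact hsup.trans (supp_antitone w h)
    · rwa [hK k h]
  · intro h
    exact ⟨fun r => solo_of_supp_eq (h r) (h (r + 1)),
      fun p hp q _ r => Journey.of_mem_supp (h r ▸ hp) q⟩

lemma fair_suffix_iff {P : Set (Fin (n + 1))} (hP : P.Nonempty) {w : IIS n} {K : ℕ} :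
    Fair P (suffix K w) ↔ ∀ k, K ≤ k → supp w k = P := by
  rw [fair_iff_supp_eq hP]
  simp only [supp_suffix]
  exact ⟨fun h k hk => by simpa [hk] using h (k - K), fun h k => h _ (by lia)⟩

/-! ### Instant graphs with prescribed views -/

lemma view_eq_iff {G H : IS n} {i : Fin (n + 1)} :
    view G i = view H i ↔ ∀ j, G.1.Adj j i ↔ H.1.Adj j i := by
  simp [Finset.ext_iff, mem_view]

lemma ext_of_view {G H : IS n} (h : ∀ i, view G i = view H i) : G = H := by
  refine Subtype.ext (Digraph.ext ?_)
  funext a b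
  exact propext (view_eq_iff.1 (h b) a)

/-- A process that no other process hears must hear all of them, so its view is determined. -/
lemma eq_of_view_eq_of_unseen {G H : IS n} {p : Fin (n + 1)}
    (h : ∀ i ≠ p, view G i = view H i) (hp : ∀ i ≠ p, ¬ G.1.Adj p i) : G = H := by
  have hp' : ∀ i ≠ p, ¬ H.1.Adj p i := fun i hi hh => hp i hi ((view_eq_iff.1 (h i hi) p).2 hh)
  refine ext_of_view fun i => ?_
  by_cases hi : i = p
  · subst hi
    rw [view_eq_iff]
    intro j
    by_cases hj : j = i
    · subst hj
      simp [adj_self]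
    · exact iff_of_true ((adj_total G i j).resolve_left (hp j hj))
        ((adj_total H i j).resolve_left (hp' j hj))
  · exact h i hi

/-- The graph `G` with `p` alone in its block: `p` is heard as in `G`, and hears apart from itself
only the processes that do not hear it. -/
def loneGraph (G : IS n) (p : Fin (n + 1)) : IS n :=
  ⟨⟨fun a b => (b = p ∧ (a = p ∨ ¬ G.1.Adj p a)) ∨ (b ≠ p ∧ G.1.Adj a b)⟩, by
    have ht := fun a b c => adj_trans G (a := a) (b := b) (c := c)
    have hc := adj_total G
    constructor
    · intro a b c
      grind
    · intro a b
      grind⟩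

/-- The graph `G` with `p` put into the first block that hears it: `p` is heard as in `G`, and
hears what every other process that hears it does. -/
def joinGraph (G : IS n) (p : Fin (n + 1)) : IS n :=
  ⟨⟨fun a b => (b = p ∧ ∀ z, z ≠ p → G.1.Adj p z → G.1.Adj a z) ∨ (b ≠ p ∧ G.1.Adj a b)⟩, by
    have ht := fun a b c => adj_trans G (a := a) (b := b) (c := c)
    have hc := adj_total G
    constructor
    · intro a b c
      grind
    · intro a b
      grind⟩

/-- Some process that hears `p` is heard by all processes that hear `p`. -/
lemma exists_first_hearer (G : IS n) {p q : Fin (n + 1)} (hq : q ≠ p) (hpq : G.1.Adj p q) :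
    ∃ s, s ≠ p ∧ G.1.Adj p s ∧ ∀ z, z ≠ p → G.1.Adj p z → G.1.Adj s z := by
  classical
  -- the views are nested, so a hearer of `p` with fewest processes in view comes first
  obtain ⟨s, hs, hmin⟩ := Finset.exists_min_image (univ.filter fun z => z ≠ p ∧ G.1.Adj p z)
    (fun z => (view G z).card) ⟨q, by simp [hq, hpq]⟩
  simp only [Finset.mem_filter, Finset.mem_univ, true_and] at hs hmin
  refine ⟨s, hs.1, hs.2, fun z hz hpz => ?_⟩
  rcases adj_total G s z with h | h
  · exact h
  · have hsub : view G z ⊆ view G s := fun k hk => mem_view.2 (adj_trans G (mem_view.1 hk) h)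
    have := Finset.eq_of_subset_of_card_le hsub (hmin z ⟨hz, hpz⟩)
    rw [← mem_view, this, mem_view]
    exact adj_self G s

/-- When `p` is heard by another process, the views of the other processes leave exactly two
possibilities for the view of `p`. -/
lemma encard_view_eq_off {G : IS n} {p q : Fin (n + 1)} (hq : q ≠ p) (hpq : G.1.Adj p q) :
    {H : IS n | ∀ i ≠ p, view G i = view H i}.encard = 2 := by
  obtain ⟨s, hsp, hps, hs⟩ := exists_first_hearer G hq hpq
  rw [Set.encard_eq_two]
  refine ⟨loneGraph G p, joinGraph G p, fun h => ?_, ?_⟩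
  · have h1 : (joinGraph G p).1.Adj s p := Or.inl ⟨rfl, hs⟩
    rw [← h] at h1
    simp only [loneGraph] at h1
    grind
  · ext H
    simp only [Set.mem_ofPred_eq, Set.mem_insert_iff, Set.mem_singleton_iff]
    constructor
    · intro h
      have hv : ∀ i, i ≠ p → ∀ j, (G.1.Adj j i ↔ H.1.Adj j i) := fun i hi =>
        view_eq_iff.1 (h i hi)
      have ht := fun a b c => adj_trans H (a := a) (b := b) (c := c)
      have hc := adj_total H
      have hr := adj_self H
      -- `p` shares its block with another process, or is alone in it
      by_cases hex : ∃ i, i ≠ p ∧ H.1.Adj p i ∧ H.1.Adj i p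
      · right
        obtain ⟨z, hzp, hpz, hz⟩ := hex
        refine ext_of_view fun i => view_eq_iff.2 fun j => ?_
        simp only [joinGraph]
        grind
      · left
        push Not at hex
        refine ext_of_view fun i => view_eq_iff.2 fun j => ?_
        simp only [loneGraph]
        grind
    · rintro (rfl | rfl) i hi <;> rw [view_eq_iff] <;> simp [loneGraph, joinGraph, hi]

/-- If no message enters `Q` and two processes lie outside `Q`, the views in `Q` do not determine
the graph: outside `Q`, all processes may hear each other, or one of them may go unheard. -/
lemma exists_ne_view_eq_on {G : IS n} {Q : Set (Fin (n + 1))} (hG : G ∈ Solo Q)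
    {p q : Fin (n + 1)} (hp : p ∉ Q) (hq : q ∉ Q) (hpq : p ≠ q) :
    ∃ H : IS n, H ≠ G ∧ ∀ i ∈ Q, view G i = view H i := by
  have ht := fun a b c => adj_trans G (a := a) (b := b) (c := c)
  have hc := adj_total G
  have hs : ∀ a b, G.1.Adj a b → b ∈ Q → a ∈ Q := hG
  let H₁ : IS n := ⟨⟨fun a b => b ∈ Q → G.1.Adj a b⟩, by
    constructor
    · intro a b c
      grind
    · intro a b
      grind⟩
  let H₂ : IS n := ⟨⟨fun a b => (b ∈ Q ∧ G.1.Adj a b) ∨ (b ∉ Q ∧ (b = q ∨ a ≠ q))⟩, by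
    constructor
    · intro a b c
      grind
    · intro a b
      grind⟩
  have hne : H₁ ≠ H₂ := fun h => by
    have h1 : H₁.1.Adj q p := fun hh => absurd hh hp
    rw [h] at h1
    simp only [H₂] at h1
    grind
  by_cases h : H₁ = G
  · exact ⟨H₂, fun h' => hne (h.trans h'.symm), fun i hi => view_eq_iff.2 fun j => by simp [H₂, hi]⟩
  · exact ⟨H₁, h, fun i hi => view_eq_iff.2 fun j => by simp [H₁, hi]⟩

/-! ### The size of the geo-classes -/

section Classes

variable {N : ℕ} {S : Fin (n + 1) → EuclideanSpace ℝ (Fin N)}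

lemma mem_geoClass_iff (hS : AffineIndependent ℝ S) {w w' : IIS n} :
    w' ∈ geoClass S w ↔ ∀ k, ∀ i ∈ supp w (k + 1), view (w k) i = view (w' k) i := by
  rw [← lam_eq_iff, ← geo_eq_iff hS]
  rfl

lemma unseen_of_supp_eq {w : IIS n} {p : Fin (n + 1)} {k : ℕ} (h : supp w k = {p}ᶜ)
    (h' : supp w (k + 1) = {p}ᶜ) : ∀ i ≠ p, ¬ (w k).1.Adj p i := fun i hi hp => by
  simpa using solo_of_supp_eq h h' p i hp (by simpa using hi)

lemma encard_geoClass_of_supp (hS : AffineIndependent ℝ S) {w : IIS n}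
    (h : (∀ k, supp w k = Set.univ) ∨ ∃ p, ∀ k, supp w k = {p}ᶜ) :
    (geoClass S w).encard = 1 := by
  rw [Set.encard_eq_one]
  refine ⟨w, Set.eq_singleton_iff_unique_mem.2 ⟨rfl, fun w' hw' => ?_⟩⟩
  rw [mem_geoClass_iff hS] at hw'
  funext k
  symm
  rcases h with h | ⟨p, h⟩
  · exact ext_of_view fun i => hw' k i (h (k + 1) ▸ Set.mem_univ i)
  · exact eq_of_view_eq_of_unseen (fun i hi => hw' k i (h (k + 1) ▸ hi))
      (unseen_of_supp_eq (h k) (h (k + 1)))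

/-- Fairness on the empty set is vacuous, and `Π ∖ {p}` is empty only if `p` is the sole process. -/
lemma fair_univ_of_compl_singleton_empty {p : Fin (n + 1)} (h : ({p}ᶜ : Set (Fin (n + 1))) = ∅)
    (w : IIS n) : Fair Set.univ w := by
  rw [Set.compl_empty_iff] at h
  have hp : ∀ q, q = p := fun q => by
    have : q ∈ ({p} : Set (Fin (n + 1))) := h ▸ Set.mem_univ q
    exact this
  refine ⟨fun r a b _ _ => trivial, fun a _ b _ r => ?_⟩
  exact ⟨0, fun _ => p, fun _ => r, le_rfl, by simp, (hp a).symm, (hp b).symm, by simp⟩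

lemma encard_geoClass_of_class₁ (hS : AffineIndependent ℝ S) {w : IIS n} (h : Class₁ w) :
    (geoClass S w).encard = 1 := by
  apply encard_geoClass_of_supp hS
  rcases h with h | ⟨p, h⟩
  · exact Or.inl ((fair_iff_supp_eq Set.univ_nonempty).1 h)
  · rcases Set.eq_empty_or_nonempty ({p}ᶜ : Set (Fin (n + 1))) with he | hne
    · exact Or.inl ((fair_iff_supp_eq Set.univ_nonempty).1
        (fair_univ_of_compl_singleton_empty he w))
    · exact Or.inr ⟨p, (fair_iff_supp_eq hne).1 h⟩

/-- The supports pass from all processes to `Π ∖ {p}` at a single round, and only there does the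
geo-class leave a choice. -/
lemma encard_geoClass_of_class₂ (hS : AffineIndependent ℝ S) {w : IIS n} (h : Class₂ w) :
    (geoClass S w).encard = 2 := by
  classical
  obtain ⟨p, hnf, K, hK⟩ := h
  have hne : ({p}ᶜ : Set (Fin (n + 1))).Nonempty := by
    rw [Set.nonempty_iff_ne_empty]
    intro he
    rw [he] at hnf
    exact hnf ⟨fun r a b _ hb => hb.elim, fun a ha => ha.elim⟩
  rw [fair_suffix_iff hne] at hK
  have hsup : ∀ k, {p}ᶜ ⊆ supp w k := fun k => by
    rw [← hK (max k K) (le_max_right _ _)]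
    exact supp_antitone w (le_max_left _ _)
  have huniv : ∀ k, supp w k ≠ {p}ᶜ → ∀ i, i ∈ supp w k := fun k hk i => by
    by_cases hi : i = p
    · by_contra hn
      exact hk ((hsup k).antisymm' fun j hj => fun hjp => hn (hi.trans hjp.symm ▸ hj))
    · exact hsup k hi
  have hex : ∃ k, supp w k = {p}ᶜ := ⟨K, hK K le_rfl⟩
  -- `m` is the last round whose support is still the set of all processes
  obtain ⟨m, hm⟩ : ∃ m, Nat.find hex = m + 1 := by
    refine Nat.exists_eq_succ_of_ne_zero fun h0 => hnf ?_
    have h1 := Nat.find_spec hex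
    rw [h0] at h1
    exact (fair_iff_supp_eq hne).2 fun k =>
      (h1 ▸ supp_antitone w (Nat.zero_le k)).antisymm (hsup k)
  have hm1 : supp w (m + 1) = {p}ᶜ := hm ▸ Nat.find_spec hex
  have hbelow : ∀ k ≤ m, ∀ i, i ∈ supp w k := fun k hk =>
    huniv k (Nat.find_min hex (by lia))
  have habove : ∀ k, m + 1 ≤ k → supp w k = {p}ᶜ := fun k hk =>
    (hm1 ▸ supp_antitone w hk).antisymm (hsup k)
  obtain ⟨q, hq, hpq⟩ := mem_supp_iff.1 (hbelow m le_rfl p)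
  rw [hm1] at hq
  have himage : geoClass S w =
      Function.update w m '' {H : IS n | ∀ i ≠ p, view (w m) i = view H i} := by
    ext w'
    rw [mem_geoClass_iff hS]
    constructor
    · intro h
      refine ⟨w' m, fun i hi => h m i (hm1 ▸ hi), ?_⟩
      funext k
      rcases lt_trichotomy k m with hk | rfl | hk
      · rw [Function.update_of_ne hk.ne]
        exact ext_of_view fun i => h k i (hbelow (k + 1) hk i)
      · simp
      · rw [Function.update_of_ne hk.ne']
        have h1 := habove (k + 1) (by lia)
        exact eq_of_view_eq_of_unseen (fun i hi => h k i (h1 ▸ hi))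
          (unseen_of_supp_eq (habove k hk) h1)
    · rintro ⟨H, hH, rfl⟩ k i hi
      by_cases hk : k = m
      · subst hk
        rw [Function.update_self]
        rw [hm1] at hi
        exact hH i hi
      · rw [Function.update_of_ne hk]
  rw [himage, (Function.update_injective w m).encard_image, encard_view_eq_off hq hpq]

/-- When two processes lie outside the eventual support, each late round leaves a choice. -/
lemma infinite_geoClass (hS : AffineIndependent ℝ S) {w : IIS n} (h₁ : ¬ Class₁ w)
    (h₂ : ¬ Class₂ w) : (geoClass S w).Infinite := by
  classical
  obtain ⟨K, hK⟩ := exists_supp_eq w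
  have hne := supp_nonempty w K
  set Q := supp w K with hQ
  obtain ⟨p, hp⟩ : ∃ p, p ∉ Q := by
    by_contra! h
    have hu : Q = Set.univ := Set.eq_univ_of_forall h
    refine h₁ (Or.inl ((fair_iff_supp_eq Set.univ_nonempty).2 fun k => ?_))
    rcases le_total k K with hk | hk
    · exact Set.univ_subset_iff.1 (hu ▸ supp_antitone w hk)
    · rw [hK k hk, hu]
  obtain ⟨q, hq, hpq⟩ : ∃ q, q ∉ Q ∧ p ≠ q := by
    by_contra! h
    have hc : Q = {p}ᶜ := by
      ext i
      refine ⟨fun hi hip => hp (hip ▸ hi), fun hi => ?_⟩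
      by_contra hn
      exact hi (h i hn).symm
    refine h₂ ⟨p, fun hf => h₁ (Or.inr ⟨p, hf⟩), K, ?_⟩
    rw [fair_suffix_iff (hc ▸ hne)]
    exact fun k hk => (hK k hk).trans hc
  have hsolo : ∀ k, w (K + k) ∈ Solo Q := fun k =>
    solo_of_supp_eq (hK _ (by lia)) (hK _ (by lia))
  choose H hHne hHview using fun k => exists_ne_view_eq_on (hsolo k) hp hq hpq
  -- changing a single late letter gives infinitely many words in the class
  refine Set.infinite_of_injective_forall_mem
    (f := fun k => Function.update w (K + k) (H k)) (fun a b hab => ?_) fun k => ?_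
  · by_contra hne'
    have h1 := congrFun hab (K + a)
    simp only [Function.update_self] at h1
    rw [Function.update_of_ne (by lia)] at h1
    exact hHne a h1
  · rw [mem_geoClass_iff hS]
    intro l i hi
    by_cases hl : l = K + k
    · subst hl
      rw [Function.update_self]
      exact hHview k i (hK (K + k + 1) (by lia) ▸ hi)
    · rw [Function.update_of_ne hl]

/-- The geometrization topology is pulled back from a Hausdorff space, so non-separable words are
those with equal images. -/
lemma setOf_nonSeparable (S : Fin (n + 1) → EuclideanSpace ℝ (Fin N)) (w : IIS n) :
    {w' | NonSeparable S w w'} = geoClass S w := by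
  ext w'
  constructor
  · intro h
    by_contra hne
    obtain ⟨U, V, hU, hV, hw, hw', hd⟩ := t2_separation (Ne.symm hne : geo S w ≠ geo S w')
    exact h ⟨geo S ⁻¹' U, geo S ⁻¹' V, ⟨U, hU, rfl⟩, ⟨V, hV, rfl⟩, hw, hw', hd.preimage _⟩
  · rintro (h : geo S w' = geo S w) ⟨A, B, ⟨U, -, rfl⟩, ⟨V, -, rfl⟩, hw, hw', hd⟩
    refine Set.disjoint_left.1 hd hw ?_
    rw [Set.mem_preimage, ← h]
    exact hw'

end Classes

end ChromaticAverage

theorem mainTheorem1 (n N : ℕ) (S : Fin (n + 1) → EuclideanSpace ℝ (Fin N))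
    (hS : AffineIndependent ℝ S) (w : ChromaticAverage.IIS n) :
    -- `geo` is a genuine limit: every vertex of the simplices of `w` converges to `geo S w`
    (∀ i, Tendsto (fun r => ChromaticAverage.state S w r i) atTop
      (𝓝 (ChromaticAverage.geo S w))) ∧
    -- the classification
    (ChromaticAverage.Class₁ w → (ChromaticAverage.geoClass S w).encard = 1) ∧
    (ChromaticAverage.Class₂ w → (ChromaticAverage.geoClass S w).encard = 2) ∧
    (¬ ChromaticAverage.Class₁ w → ¬ ChromaticAverage.Class₂ w →
      (ChromaticAverage.geoClass S w).Infinite) ∧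
    -- the executions that cannot be separated from `w` form the geo-class of `w`,
    -- and their number is 1, 2 or infinite
    {w' | ChromaticAverage.NonSeparable S w w'} = ChromaticAverage.geoClass S w ∧
    ({w' | ChromaticAverage.NonSeparable S w w'}.encard = 1 ∨
      {w' | ChromaticAverage.NonSeparable S w w'}.encard = 2 ∨
      {w' | ChromaticAverage.NonSeparable S w w'}.Infinite) := by
  have h₁ := ChromaticAverage.encard_geoClass_of_class₁ hS (w := w)
  have h₂ := ChromaticAverage.encard_geoClass_of_class₂ hS (w := w)
  have h₃ := ChromaticAverage.infinite_geoClass hS (w := w)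
  refine ⟨fun i => ?_, h₁, h₂, h₃, ChromaticAverage.setOf_nonSeparable S w, ?_⟩
  · rw [ChromaticAverage.geo_eq_sum]
    exact ChromaticAverage.tendsto_state_sum S w i
  · rw [ChromaticAverage.setOf_nonSeparable S w]
    by_cases c₁ : ChromaticAverage.Class₁ w
    · exact Or.inl (h₁ c₁)
    · by_cases c₂ : ChromaticAverage.Class₂ w
      · exact Or.inr (Or.inl (h₂ c₂))
      · exact Or.inr (Or.inr (h₃ c₁ c₂))
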